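/- **Conventions.** Let $\mathbb F_\omega$ be the free group on letters $(a_i)_{i\in\mathbb N}$ and let $(\gamma_i)_{i\in\mathbb N}$ be any enumeration of $\mathbb F_\omega$ (repetitions allowed). The space of marked groups $\mathscr G$ is the set of normal subgroups $N\trianglelefteq\mathbb F_\omega$ with the topology induced from the Cantor space $2^{\mathbb F_\omega}$; it is a compact Polish space. A point $N$ is identified with $G=\mathbb F_\omega/N$, with projection $f_N$, marked by the generators $f_N(a_i)$ and enumerated by $g_i:=f_N(\gamma_i)$. A subgroup $H\le G$ is viewed as a point of $\mathscr G$ via the marking $a_i\mapsto g_i$ if $g_i\in H$ and $a_i\mapsto e$ otherwise; the subgroup $R_n(G):=\langle g_0,\dots,g_n\rangle$ is viewed as a point of $\mathscr G$ via the marking $a_i\mapsto g_i$ for $i\le n$ and $a_i\mapsto e$ for $i>n$. The class of elementary amenable groups is the smallest class of countable groups containing all finite and all countable abelian groups and closed under extensions, countable increasing unions, subgroups and quotients; $\mathrm{EG}\subseteq\mathscr G$ is the set of marked groups $\mathbb F_\omega/N$ that are elementary amenable. For $k\ge1$ put $S_k(G):=[G,G]\cap\bigcap\{M\trianglelefteq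 G : |G:M|\le k+1\}$. For $l\ge 1$ the decomposition tree $T^l(G)\subseteq\mathbb N^{<\mathbb N}$ and the marked groups $G_s$ ($s\in T^l(G)$) are defined recursively: $\emptyset\in T^l(G)$ and $G_\emptyset:=G$; if $s\in T^l(G)$ and $G_s\ne\{e\}$, then for every $n\in\mathbb N$, $s^\smallfrown n\in T^l(G)$ and $G_{s^\smallfrown n}:=S_{|s|+l}(R_n(G_s))$. A tree $T\subseteq\mathbb N^{<\mathbb N}$ is well-founded if there is no $x\in\mathbb N^{\mathbb N}$ all of whose finite initial segments lie in $T$. For a nonempty well-founded tree put $\rho(T):=\rho_T(\emptyset)+1$, where $\rho_T(t):=\sup\{\rho_T(s)+1 : s\in T,\ t\subsetneq s\}$ (with $\sup\emptyset=0$); put $\rho(T):=\omega_1$ if $T$ is not well-founded and $\rho(\emptyset):=0$. Let $\mathrm W$ be the set of $G\in\mathscr G$ such that $T^l(G)$ is well-founded for some $l\ge1$. The decomposition rank of $G\in\mathrm W$ is $\xi(G):=\min_{l\ge1}\rho(T^l(G))$. For a Polish space $X$ and $A\subseteq X$, a function $\phi\colon A\to\mathrm{ORD}$ is a $\Pi^1_1$-rank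 if there are a co-analytic relation $\le^{\Pi}\ \subseteq X\times X$ and an analytic relation $\le^{\Sigma}\ \subseteq X\times X$ such that for all $y\in A$ and all $x\in X$, $$x\in A\ \wedge\ \phi(x)\le\phi(y)\iff x\le^{\Sigma}y\iff x\le^{\Pi}y.$$ **Theorem.** $\mathrm{EG}\subseteq\mathrm W$, so that the decomposition rank $\xi$ is defined on $\mathrm{EG}$, and $\xi\colon\mathrm{EG}\to\mathrm{ORD}$ is a $\Pi^1_1$-rank on $\mathrm{EG}$ (as a subset of $\mathscr G$). -/

import Mathlib

open Set Topology Ordinal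

/-! ### Descriptive set theory -/

/-- `φ : A → ORD` is a `Π¹₁`-rank on the subset `A` of the Polish space `X`: there are a
co-analytic relation `rPi` and an analytic relation `rSigma` on `X` such that for all `y ∈ A`
and all `x ∈ X`,
`(x ∈ A ∧ φ x ≤ φ y) ↔ rSigma x y` and `(x ∈ A ∧ φ x ≤ φ y) ↔ rPi x y`. -/
def IsPi11Rank {X : Type*} [TopologicalSpace X] [PolishSpace X] (A : Set X)
    (φ : A → Ordinal.{0}) : Prop :=
  ∃ rPi rSigma : Set (X × X),
    MeasureTheory.AnalyticSet rPiᶜ ∧ MeasureTheory.AnalyticSet rSigma ∧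
    ∀ (y : A) (x : X),
      ((∃ hx : x ∈ A, φ ⟨x, hx⟩ ≤ φ y) ↔ (x, (y : X)) ∈ rSigma) ∧
      ((∃ hx : x ∈ A, φ ⟨x, hx⟩ ≤ φ y) ↔ (x, (y : X)) ∈ rPi)

/-- A (descriptive-set-theoretic) tree: a set of finite sequences of natural numbers that is
closed under initial segments. -/
structure SeqTree where
  nodes : Set (List ℕ)
  prefix_mem : ∀ s ∈ nodes, ∀ t : List ℕ, t <+: s → t ∈ nodes

namespace SeqTree

/-- `x` is a branch of `T` if all its finite initial segments `(x 0, …, x (n - 1))` lie in `T`. -/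
def IsBranch (T : SeqTree) (x : ℕ → ℕ) : Prop :=
  ∀ n : ℕ, (List.range n).map x ∈ T.nodes

/-- A tree is well-founded if it has no branch. -/
def WF (T : SeqTree) : Prop :=
  ¬ ∃ x : ℕ → ℕ, T.IsBranch x

/-- `s` is a proper extension of `t`, both being nodes of `T`. -/
def Extends (T : SeqTree) (s t : List ℕ) : Prop :=
  s ∈ T.nodes ∧ t ∈ T.nodes ∧ t <+: s ∧ t ≠ s

/-- Proper extension in a tree without branches is a well-founded relation. -/
theorem WF.wellFounded {T : SeqTree} (hT : T.WF) : WellFounded T.Extends := by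
  rw [wellFounded_iff_isEmpty_descending_chain]
  refine ⟨fun ⟨f, hf⟩ => hT ?_⟩
  have hlen : ∀ n, n ≤ (f n).length := by
    intro n
    induction n with
    | zero => exact Nat.zero_le _
    | succ n ih =>
      obtain ⟨-, -, hp, hne⟩ := hf n
      have h1 := hp.length_le
      have h2 : (f n).length ≠ (f (n + 1)).length := fun h => hne (hp.eq_of_length h)
      omega
  have hpre : ∀ m n, m ≤ n → f m <+: f n := by
    intro m n hmn
    induction n, hmn using Nat.le_induction with
    | base => exact List.prefix_refl _
    | succ n _ ih => exact ih.trans (hf n).2.2.1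
  refine ⟨fun i => (f (i + 1)).getD i 0, fun n => ?_⟩
  refine T.prefix_mem (f n) (hf n).2.1 _ ?_
  have hn := hlen n
  have : (List.range n).map (fun i => (f (i + 1)).getD i 0) = (f n).take n := by
    apply List.ext_getElem
    · simp [hn]
    · intro i h1 h2
      have hi : i < n := by simpa using h1
      have hi' : i < (f (i + 1)).length := hlen (i + 1)
      have := (hpre (i + 1) n hi).getElem hi'
      simp only [List.getElem_map, List.getElem_range, List.getElem_take]
      rw [List.getD_eq_getElem _ _ hi', this]
  rw [this]
  exact List.take_prefix _ _

open Classical in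
/-- The rank `ρ(T)` of a tree. For a nonempty well-founded tree it is `ρ_T(∅) + 1`, where
`ρ_T(t) = sup {ρ_T(s) + 1 | s ∈ T properly extends t}`; it is `0` for the empty tree and `ω₁`
for ill-founded trees. -/
noncomputable def rank (T : SeqTree) : Ordinal.{0} :=
  if T.nodes = ∅ then 0
  else if h : T.WF then (h.wellFounded.apply []).rank + 1
  else ω₁

end SeqTree

/-! ### The space of marked groups -/

/-- A marked group: a normal subgroup `N` of the free group on the letters `(a_i)_{i ∈ ℕ}`,
standing for the group `F_ω / N`. -/
@[ext] structure MarkedGroup where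
  ker : Subgroup (FreeGroup ℕ)
  normal : ker.Normal

namespace MarkedGroup

instance (G : MarkedGroup) : G.ker.Normal := G.normal

/-- The group `F_ω / N` underlying a marked group. -/
abbrev Carrier (G : MarkedGroup) : Type := FreeGroup ℕ ⧸ G.ker

/-- The projection `f_N : F_ω → F_ω / N`. -/
noncomputable def proj (G : MarkedGroup) : FreeGroup ℕ →* G.Carrier := QuotientGroup.mk' G.ker

open Classical in
/-- The characteristic function of the normal subgroup, a point of the Cantor space. -/
noncomputable def charFun (G : MarkedGroup) : FreeGroup ℕ → Bool := fun w => decide (w ∈ G.ker)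

/-- The topology of the space of marked groups, as a subspace of `2 ^ F_ω`. -/
noncomputable instance : TopologicalSpace MarkedGroup := TopologicalSpace.induced charFun inferInstance

theorem isClosedEmbedding_charFun : IsClosedEmbedding charFun := by
  have hinj : Function.Injective charFun := by
    intro G H h
    ext w
    simpa [charFun] using congrFun h w
  refine ⟨⟨⟨rfl⟩, hinj⟩, ?_⟩
  have hr : range charFun =
      {x : FreeGroup ℕ → Bool | x 1 = true} ∩
      {x | ∀ u v, x u = true → x v = true → x (u * v) = true} ∩
      {x | ∀ u, x u = true → x u⁻¹ = true} ∩
      {x | ∀ u g, x u = true → x (g * u * g⁻¹) = true} := by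
    ext x
    constructor
    · rintro ⟨G, rfl⟩
      refine ⟨⟨⟨?_, ?_⟩, ?_⟩, ?_⟩
      · simp [charFun, G.ker.one_mem]
      · intro u v hu hv
        simp only [charFun, decide_eq_true_eq] at *
        exact G.ker.mul_mem hu hv
      · intro u hu
        simp only [charFun, decide_eq_true_eq] at *
        exact G.ker.inv_mem hu
      · intro u g hu
        simp only [charFun, decide_eq_true_eq] at *
        exact G.normal.conj_mem u hu g
    · rintro ⟨⟨⟨h1, hm⟩, hi⟩, hc⟩
      refine ⟨⟨{ carrier := {w | x w = true}
                 one_mem' := h1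
                 mul_mem' := fun {a b} ha hb => hm a b ha hb
                 inv_mem' := fun {a} ha => hi a ha }, ⟨fun n hn g => hc n g hn⟩⟩, ?_⟩
      funext w
      by_cases hw : x w = true <;> simp [charFun, ← SetLike.mem_coe, hw]
  have hcl : ∀ w : FreeGroup ℕ, IsClopen {x : FreeGroup ℕ → Bool | x w = true} := fun w =>
    (isClopen_discrete ({true} : Set Bool)).preimage (continuous_apply w)
  rw [hr]
  refine ((((hcl 1).isClosed).inter ?_).inter ?_).inter ?_
  · simp only [ofPred_forall]
    exact isClosed_iInter fun u => isClosed_iInter fun v =>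
      isClosed_imp (hcl u).isOpen (isClosed_imp (hcl v).isOpen (hcl (u * v)).isClosed)
  · simp only [ofPred_forall]
    exact isClosed_iInter fun u => isClosed_imp (hcl u).isOpen (hcl u⁻¹).isClosed
  · simp only [ofPred_forall]
    exact isClosed_iInter fun u => isClosed_iInter fun g =>
      isClosed_imp (hcl u).isOpen (hcl (g * u * g⁻¹)).isClosed

instance : PolishSpace MarkedGroup := by
  have : TopologicalSpace.SeparableSpace (FreeGroup ℕ → Bool) :=
    TopologicalSpace.SecondCountableTopology.to_separableSpace
  exact isClosedEmbedding_charFun.polishSpace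

end MarkedGroup

/-! ### Elementary amenable groups -/

/-- The class of elementary amenable groups: the smallest class of countable groups that contains
the finite groups and the (countable) abelian groups and is closed under extensions, countable
increasing unions, subgroups and quotients. (Countability propagates through all the clauses.) -/
inductive IsElementaryAmenable : (G : Type) → [Group G] → Prop
  | of_finite (G : Type) [Group G] (h : Finite G) : IsElementaryAmenable G
  | of_comm (G : Type) [Group G] (hc : Countable G) (h : ∀ a b : G, a * b = b * a) :
      IsElementaryAmenable G
  | extension (N G Q : Type) [Group N] [Group G] [Group Q] (i : N →* G) (p : G →* Q)
      (hi : Function.Injective i) (hp : Function.Surjective p) (hip : i.range = p.ker)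
      (hN : IsElementaryAmenable N) (hQ : IsElementaryAmenable Q) : IsElementaryAmenable G
  | union (G : Type) [Group G] (H : ℕ → Subgroup G) (hmono : Monotone H)
      (hunion : ∀ g : G, ∃ n, g ∈ H n) (hH : ∀ n, IsElementaryAmenable (H n)) :
      IsElementaryAmenable G
  | subgroup (H G : Type) [Group H] [Group G] (i : H →* G) (hi : Function.Injective i)
      (hG : IsElementaryAmenable G) : IsElementaryAmenable H
  | quotient (G Q : Type) [Group G] [Group Q] (p : G →* Q) (hp : Function.Surjective p)
      (hG : IsElementaryAmenable G) : IsElementaryAmenable Q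

/-- The set `EG` of elementary amenable marked groups. -/
def EG : Set MarkedGroup := {G | IsElementaryAmenable G.Carrier}

/-! ### Decomposition trees

Throughout, `γ : ℕ → F_ω` is a fixed enumeration of the free group, which induces the enumeration
`g_i = f_N (γ i)` of every marked group `F_ω / N`. -/

/-- `[G,G] ∩ ⋂ {N ⊴ G : |G : N| ≤ k + 1}`. (`Subgroup.index` is `0` for infinite index.) -/
def commFiniteResidual (G : Type*) [Group G] (k : ℕ) : Subgroup G :=
  commutator G ⊓ sInf {N : Subgroup G | N.Normal ∧ N.index ≠ 0 ∧ N.index ≤ k + 1}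

namespace MarkedGroup

variable (γ : ℕ → FreeGroup ℕ)

/-- The marked group `F_ω / ker (f_N ∘ π)` for an endomorphism `π` of `F_ω`; it is isomorphic to
the image of `f_N ∘ π`. -/
noncomputable def pullback (G : MarkedGroup) (π : FreeGroup ℕ →* FreeGroup ℕ) : MarkedGroup where
  ker := (G.proj.comp π).ker
  normal := inferInstance

/-- The subgroup `⟨g_0, …, g_n⟩`, marked by `a_i ↦ g_i` for `i ≤ n` and `a_i ↦ e` for `i > n`. -/
noncomputable def R (n : ℕ) (G : MarkedGroup) : MarkedGroup :=
  G.pullback (FreeGroup.lift fun i => if i ≤ n then γ i else 1)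

open Classical in
/-- A subgroup `H` of a marked group, marked by `a_i ↦ g_i` if `g_i ∈ H` and `a_i ↦ e` if not. -/
noncomputable def ofSubgroup (G : MarkedGroup) (H : Subgroup G.Carrier) : MarkedGroup :=
  G.pullback (FreeGroup.lift fun i => if G.proj (γ i) ∈ H then γ i else 1)

/-- The subgroup `S_k(G) = [G,G] ∩ ⋂ {N ⊴ G : |G : N| ≤ k + 1}` as a marked group. -/
noncomputable def S (k : ℕ) (G : MarkedGroup) : MarkedGroup :=
  G.ofSubgroup γ (commFiniteResidual G.Carrier k)

/-- `DecompNode γ l G s H` says that `s ∈ T^l(G)` and `G_s = H`: the empty sequence is a node with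
`G_∅ = G`, and if `s` is a node with `G_s ≠ {e}`, then every `s⌢n` is a node with
`G_{s⌢n} = S_{|s|+l}(R_n(G_s))`. -/
inductive DecompNode (l : ℕ) (G : MarkedGroup) : List ℕ → MarkedGroup → Prop
  | nil : DecompNode l G [] G
  | snoc (s : List ℕ) (H : MarkedGroup) (n : ℕ) (hs : DecompNode l G s H)
      (hH : Nontrivial H.Carrier) :
      DecompNode l G (s ++ [n]) (S γ (s.length + l) (R γ n H))

/-- The decomposition tree `T^l(G)` of `G` with offset `l`. -/
def decompositionTree (l : ℕ) (G : MarkedGroup) : SeqTree where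
  nodes := {s | ∃ H, DecompNode γ l G s H}
  prefix_mem := by
    rintro s ⟨H, hs⟩
    induction hs with
    | nil =>
      intro t ht
      rw [List.prefix_nil.1 ht]
      exact ⟨G, .nil⟩
    | snoc s H n hs hH ih =>
      intro t ht
      rcases List.prefix_concat_iff.1 ht with rfl | h
      · exact ⟨_, .snoc s H n hs hH⟩
      · exact ih t h

/-- The set `W` of marked groups some decomposition tree (with offset `l ≥ 1`) of which is
well-founded. -/
def W : Set MarkedGroup := {G | ∃ l : ℕ, 1 ≤ l ∧ (decompositionTree γ l G).WF}

/-- The decomposition rank `ξ(G) = min {ρ(T^l(G)) | l ≥ 1}`. -/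
noncomputable def decompositionRank (G : MarkedGroup) : Ordinal.{0} :=
  sInf {α | ∃ l : ℕ, 1 ≤ l ∧ α = (decompositionTree γ l G).rank}

end MarkedGroup

/-! ### Comparing tree ranks by extension-preserving maps. -/

namespace SeqTree

/-! Elementary amenability of `G` is equivalent to well-foundedness of one, or of every,
decomposition tree of `G`. A branch gives a descending chain of finitely generated subgroups of `G`,
each inside the residual `S_k` of its predecessor with `k` growing; induction over the elementary
amenable class shows that such chains become trivial (`IsElementaryAmenable.residualChainsEnd`,
`wf_decompositionTree`). Conversely, a finitely generated group is built from its `S_k` by a finite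
and an abelian extension, and `G` is the union of the `R_n(G)`, so well-founded induction along a
tree yields elementary amenability (`isElementaryAmenable_of_wf`).

Hence, for `y` in `EG`, the condition that `x` lies in `EG` with rank at most that of `y` says: for
every offset of `y` some offset of `x` gives a well-founded tree of no larger rank. If `T` is
well-founded, "`S` is well-founded of rank at most that of `T`" means that some map `S → T`
preserves proper extension, and its negation means that some such map `T → S` moves the root off the
root (`WF.exists_isHom_iff`, `WF.exists_strict_isHom_iff`). Since trees depend on `G` in a Borel
way, both existence statements are analytic; the first gives the analytic relation, the second the
co-analytic one. -/

theorem WF.rank_eq {T : SeqTree} (hT : T.WF) (h0 : [] ∈ T.nodes) :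
    T.rank = (hT.wellFounded.apply []).rank + 1 := by
  have : T.nodes ≠ ∅ := fun h => by simp [h] at h0
  rw [rank, if_neg this, dif_pos hT]

/-- `f` maps proper extensions in `S` to proper extensions in `T`. -/
def IsHom (S T : SeqTree) (f : List ℕ → List ℕ) : Prop :=
  f [] ∈ T.nodes ∧ ∀ s t, S.Extends s t → T.Extends (f s) (f t)

theorem IsBranch.extends {S : SeqTree} {x : ℕ → ℕ} (hx : S.IsBranch x) {m n : ℕ} (h : m < n) :
    S.Extends ((List.range n).map x) ((List.range m).map x) := by
  refine ⟨hx n, hx m, ?_, fun he => ?_⟩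
  · obtain ⟨k, rfl⟩ := Nat.exists_eq_add_of_le h.le
    rw [List.range_add, List.map_append]
    exact List.prefix_append _ _
  · have := congrArg List.length he
    simp at this
    omega

theorem WF.of_isHom {S T : SeqTree} (hT : T.WF) {f : List ℕ → List ℕ} (hf : S.IsHom T f) :
    S.WF := by
  rintro ⟨x, hx⟩
  refine (wellFounded_iff_isEmpty_descending_chain.1 hT.wellFounded).false
    ⟨fun n => f ((List.range n).map x), fun n => ?_⟩
  exact hf.2 _ _ (hx.extends n.lt_succ_self)

theorem IsHom.acc_rank_le {S T : SeqTree} {f : List ℕ → List ℕ} (hf : S.IsHom T f)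
    (s : List ℕ) (hs : Acc S.Extends s) (ht : Acc T.Extends (f s)) : hs.rank ≤ ht.rank := by
  induction hs with
  | intro s h ih =>
    rw [Acc.rank_eq]
    refine Ordinal.iSup_le fun ⟨b, hb⟩ => ?_
    have hb' := hf.2 _ _ hb
    exact Order.succ_le_of_lt ((ih b hb (ht.inv hb')).trans_lt (ht.rank_lt_of_rel hb'))

/-- The map is built node by node, keeping the rank of each node at most the rank of its image; this
leaves room for a proper extension at each step. -/
theorem exists_isHom {S T : SeqTree} (hS : S.WF) (hT : T.WF) (t₀ : List ℕ) (ht₀ : t₀ ∈ T.nodes)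
    (hle : (hS.wellFounded.apply []).rank ≤ (hT.wellFounded.apply t₀).rank) :
    ∃ f, S.IsHom T f ∧ f [] = t₀ := by
  classical
  set rS : List ℕ → Ordinal := fun s => (hS.wellFounded.apply s).rank with hrS
  set rT : List ℕ → Ordinal := fun s => (hT.wellFounded.apply s).rank with hrT
  have step : ∀ s t n, s ++ [n] ∈ S.nodes → rS s ≤ rT t →
      ∃ t', T.Extends t' t ∧ rS (s ++ [n]) ≤ rT t' := by
    intro s t n hn hst
    have hlt : rS (s ++ [n]) < rT t := by
      refine lt_of_lt_of_le ?_ hst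
      exact Acc.rank_lt_of_rel _ ⟨hn, S.prefix_mem _ hn _ (List.prefix_append _ _),
        List.prefix_append _ _, by simp⟩
    simp only [hrT] at hlt
    rw [Acc.rank_eq, Ordinal.lt_iSup_iff] at hlt
    obtain ⟨⟨b, hb⟩, h⟩ := hlt
    exact ⟨b, hb, Order.lt_succ_iff.1 h⟩
  choose! next hnext using step
  -- Nodes are reversed so that appending a last entry becomes `cons`, on which recursion is
  -- structural.
  let g : List ℕ → List ℕ := fun s => List.rec t₀ (fun n s t => next s.reverse t n) s
  have hg : ∀ s : List ℕ, s.reverse ∈ S.nodes → g s ∈ T.nodes ∧ rS s.reverse ≤ rT (g s) := by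
    intro s
    induction s with
    | nil => exact fun _ => ⟨ht₀, hle⟩
    | cons n s ih =>
      intro h
      rw [List.reverse_cons] at h
      have h' := ih (S.prefix_mem _ h _ (List.prefix_append _ _))
      have := hnext s.reverse (g s) n h h'.2
      rw [List.reverse_cons]
      exact ⟨this.1.1, this.2⟩
  have hstep : ∀ (s : List ℕ) n, s ++ [n] ∈ S.nodes →
      T.Extends (g (s ++ [n]).reverse) (g s.reverse) := by
    intro s n h
    have h' := hg s.reverse (by
      rw [List.reverse_reverse]; exact S.prefix_mem _ h _ (List.prefix_append _ _))
    rw [List.reverse_reverse] at h'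
    have := (hnext s (g s.reverse) n h h'.2).1
    rw [List.reverse_append, List.reverse_singleton, List.singleton_append]
    simpa [g] using this
  have htrans : ∀ a b c, T.Extends a b → T.Extends b c → T.Extends a c := by
    rintro a b c ⟨ha, hb, hp, hne⟩ ⟨_, hc, hp', hne'⟩
    refine ⟨ha, hc, hp'.trans hp, fun h => ?_⟩
    subst h
    exact hne (hp.eq_of_length (le_antisymm hp.length_le hp'.length_le))
  refine ⟨fun s => g s.reverse, ⟨ht₀, ?_⟩, rfl⟩
  intro s t
  induction s using List.reverseRecOn with
  | nil =>
    rintro ⟨_, _, hp, hne⟩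
    exact absurd (List.prefix_nil.1 hp) hne
  | append_singleton s n ih =>
    rintro ⟨hs, ht, hp, hne⟩
    rcases List.prefix_concat_iff.1 hp with h | h
    · exact absurd h hne
    · by_cases hst : t = s
      · subst hst; exact hstep t n hs
      · exact htrans _ _ _ (hstep s n hs)
          (ih ⟨S.prefix_mem _ hs _ (List.prefix_append _ _), ht, h, hst⟩)

theorem WF.exists_isHom_iff {S T : SeqTree} (hT : T.WF) (hS0 : [] ∈ S.nodes)
    (hT0 : [] ∈ T.nodes) : (∃ f, S.IsHom T f) ↔ S.WF ∧ S.rank ≤ T.rank := by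
  constructor
  · rintro ⟨f, hf⟩
    have hS := hT.of_isHom hf
    refine ⟨hS, ?_⟩
    rw [hS.rank_eq hS0, hT.rank_eq hT0]
    refine add_le_add_left ((hf.acc_rank_le [] (hS.wellFounded.apply [])
      (hT.wellFounded.apply _)).trans ?_) 1
    -- The root may be sent to a proper extension of the root, which only has smaller rank.
    by_cases h : f [] = []
    · rw [h]
    · exact (Acc.rank_lt_of_rel (hT.wellFounded.apply [])
        ⟨hf.1, hT0, List.nil_prefix, Ne.symm h⟩).le
  · rintro ⟨hS, hle⟩
    rw [hS.rank_eq hS0, hT.rank_eq hT0] at hle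
    obtain ⟨f, hf, -⟩ := exists_isHom hS hT [] hT0 (Order.succ_le_succ_iff.1 hle)
    exact ⟨f, hf⟩

/-- Sending the root to a proper extension forces a strict rank inequality. Conversely, a strictly
larger rank of `S` is witnessed at a node above the root, and an ill-founded `S` accepts any tree
along a branch. -/
theorem WF.exists_strict_isHom_iff {S T : SeqTree} (hT : T.WF) (hS0 : [] ∈ S.nodes)
    (hT0 : [] ∈ T.nodes) :
    (∃ f, T.IsHom S f ∧ f [] ≠ []) ↔ ¬ (S.WF ∧ S.rank ≤ T.rank) := by
  constructor
  · rintro ⟨f, hf, hne⟩ ⟨hS, hle⟩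
    rw [hS.rank_eq hS0, hT.rank_eq hT0] at hle
    exact absurd (Order.succ_le_succ_iff.1 hle) (not_le.2
      ((hf.acc_rank_le [] (hT.wellFounded.apply []) (hS.wellFounded.apply _)).trans_lt
      (Acc.rank_lt_of_rel (hS.wellFounded.apply []) ⟨hf.1, hS0, List.nil_prefix, Ne.symm hne⟩)))
  · intro h
    by_cases hS : S.WF
    · have hlt : T.rank < S.rank := not_le.1 fun hle => h ⟨hS, hle⟩
      rw [hS.rank_eq hS0, hT.rank_eq hT0] at hlt
      replace hlt := Order.succ_lt_succ_iff.1 hlt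
      rw [(hS.wellFounded.apply []).rank_eq, Ordinal.lt_iSup_iff] at hlt
      obtain ⟨⟨s, hs⟩, hlt⟩ := hlt
      obtain ⟨f, hf, hf0⟩ := exists_isHom hT hS s hs.1 (Order.lt_succ_iff.1 hlt)
      exact ⟨f, hf, hf0 ▸ Ne.symm hs.2.2.2⟩
    · obtain ⟨x, hx⟩ := not_not.1 hS
      -- Nodes go to initial segments of the branch by length; the extra `1` moves the root off the
      -- root.
      refine ⟨fun t => (List.range (t.length + 1)).map x, ⟨hx _, ?_⟩, by simp⟩
      rintro s t ⟨_, _, hp, hne⟩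
      refine hx.extends ?_
      have := hp.length_le
      have h2 : t.length ≠ s.length := fun h => hne (hp.eq_of_length h)
      omega

end SeqTree

/-! ### Residuals and descending residual chains. -/

theorem mem_commFiniteResidual {G : Type*} [Group G] {k : ℕ} {g : G} :
    g ∈ commFiniteResidual G k ↔ g ∈ commutator G ∧
      ∀ M : Subgroup G, M.Normal → M.index ≠ 0 → M.index ≤ k + 1 → g ∈ M := by
  simp only [commFiniteResidual, Subgroup.mem_inf, Subgroup.mem_sInf, mem_ofPred_eq]
  exact and_congr_right fun _ => ⟨fun h M h1 h2 h3 => h M ⟨h1, h2, h3⟩,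
    fun h M hM => h M hM.1 hM.2.1 hM.2.2⟩

/-- The preimage of a normal subgroup is normal and its index divides the original one, so the bound
on the index survives. This functoriality transports chains to quotients and subgroups. -/
theorem map_mem_commFiniteResidual {A B : Type*} [Group A] [Group B] (f : A →* B) {k : ℕ} {a : A}
    (ha : a ∈ commFiniteResidual A k) : f a ∈ commFiniteResidual B k := by
  rw [mem_commFiniteResidual] at ha ⊢
  refine ⟨?_, fun M hM h0 hk => ?_⟩
  · have := Subgroup.mem_map_of_mem f ha.1
    rw [map_commutator_eq] at this
    exact Subgroup.commutator_mono le_top le_top this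
  · have hd : (M.comap f).index ∣ M.index := by
      rw [Subgroup.index_comap]
      exact Subgroup.relIndex_dvd_index_of_normal M _
    exact ha.2 (M.comap f) (hM.comap f) (fun h => h0 (by rw [h] at hd; exact zero_dvd_iff.1 hd))
      ((Nat.le_of_dvd (Nat.pos_of_ne_zero h0) hd).trans hk)

/-- A descending chain of finitely generated subgroups, each of which lies in the subgroup
`commFiniteResidual` of the previous one, with indices growing from the offset `l`. -/
def IsResidualChain (G : Type*) [Group G] (l : ℕ) (K : ℕ → Subgroup G) : Prop :=
  (∀ i, Group.FG (K i)) ∧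
    ∀ i, ∀ g ∈ K (i + 1), ∃ h : g ∈ K i, (⟨g, h⟩ : K i) ∈ commFiniteResidual (K i) (i + l)

/-- Every residual chain of subgroups of `G` reaches the trivial subgroup. -/
def ResidualChainsEnd (G : Type*) [Group G] : Prop :=
  ∀ l K, IsResidualChain G l K → ∃ i, K i = ⊥

namespace IsResidualChain

variable {G : Type*} [Group G] {l : ℕ} {K : ℕ → Subgroup G}

theorem antitone (hK : IsResidualChain G l K) : Antitone K :=
  antitone_nat_of_succ_le fun i g hg => (hK.2 i g hg).1

theorem map {H : Type*} [Group H] (hK : IsResidualChain G l K) (f : G →* H) :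
    IsResidualChain H l fun i => (K i).map f := by
  refine ⟨fun i => ?_, ?_⟩
  · have := hK.1 i
    exact Group.fg_of_surjective (f.subgroupMap_surjective (K i))
  · rintro i _ ⟨g, hg, rfl⟩
    obtain ⟨h, h'⟩ := hK.2 i g hg
    exact ⟨Subgroup.mem_map_of_mem f h, map_mem_commFiniteResidual (f.subgroupMap (K i)) h'⟩

theorem shift (hK : IsResidualChain G l K) (m : ℕ) :
    IsResidualChain G (m + l) fun i => K (i + m) := by
  refine ⟨fun i => hK.1 _, fun i g hg => ?_⟩
  have h1 : i + 1 + m = i + m + 1 := by omega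
  simp only [h1] at hg
  rw [← add_assoc]
  exact hK.2 (i + m) g hg

theorem subgroupOf (hK : IsResidualChain G l K) {N : Subgroup G} (hN : K 0 ≤ N) :
    IsResidualChain N l fun i => (K i).subgroupOf N := by
  have hle : ∀ i, K i ≤ N := fun i => (hK.antitone (Nat.zero_le i)).trans hN
  refine ⟨fun i => ?_, ?_⟩
  · have := hK.1 i
    exact Group.fg_of_surjective (f := (Subgroup.subgroupOfEquivOfLe (hle i)).symm.toMonoidHom)
      (Subgroup.subgroupOfEquivOfLe (hle i)).symm.surjective
  · rintro i g hg
    obtain ⟨h, h'⟩ := hK.2 i g (Subgroup.mem_subgroupOf.1 hg)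
    exact ⟨Subgroup.mem_subgroupOf.2 h, map_mem_commFiniteResidual
      (Subgroup.subgroupOfEquivOfLe (hle i)).symm.toMonoidHom h'⟩

end IsResidualChain

namespace ResidualChainsEnd

variable {G : Type*} [Group G]

theorem of_finite [Finite G] : ResidualChainsEnd G := by
  intro l K hK
  -- At stage `Nat.card G` the index bound exceeds the order of the group, so `⊥` is among the
  -- subgroups intersected.
  refine ⟨Nat.card G + 1, (Subgroup.eq_bot_iff_forall _).2 fun g hg => ?_⟩
  obtain ⟨h, h'⟩ := hK.2 _ g hg
  have hc := Subgroup.card_le_card_group (K (Nat.card G))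
  have := (mem_commFiniteResidual.1 h').2 ⊥ inferInstance
    (by rw [Subgroup.index_bot]; exact Nat.card_pos.ne')
    (by rw [Subgroup.index_bot]; omega)
  simpa using this

theorem of_comm (h : ∀ a b : G, a * b = b * a) : ResidualChainsEnd G := by
  intro l K hK
  refine ⟨1, (Subgroup.eq_bot_iff_forall _).2 fun g hg => ?_⟩
  obtain ⟨h1, h'⟩ := hK.2 0 g hg
  have h2 := (mem_commFiniteResidual.1 h').1
  have h3 : commutator (K 0) = ⊥ := by
    rw [commutator_def, Subgroup.commutator_eq_bot_iff_le_centralizer]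
    intro a _
    rw [Subgroup.mem_centralizer_iff]
    intro b _
    exact Subtype.ext (h _ _)
  rw [h3] at h2
  simpa using h2

/-- A tail of the chain is a chain in `N` with a larger offset; this is why `ResidualChainsEnd`
quantifies over all offsets. -/
theorem of_bot_of_subgroup {N : Subgroup G} (hN : ResidualChainsEnd N) {l : ℕ}
    {K : ℕ → Subgroup G} (hK : IsResidualChain G l K) (h : ∃ m, K m ≤ N) : ∃ i, K i = ⊥ := by
  obtain ⟨m, hm⟩ := h
  have h0 : K (0 + m) ≤ N := by rwa [zero_add]
  obtain ⟨i, hi⟩ := hN _ _ ((hK.shift m).subgroupOf h0)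
  refine ⟨i + m, ?_⟩
  have hle : K (i + m) ≤ N := (hK.antitone (Nat.le_add_left m i)).trans hm
  exact (Subgroup.subgroupOf_eq_bot.1 hi).eq_bot_of_le hle

/-- The image of the chain in the quotient becomes trivial, so from some stage on the chain lives in
`N`. -/
theorem extension (N : Subgroup G) [N.Normal] (hN : ResidualChainsEnd N)
    (hQ : ResidualChainsEnd (G ⧸ N)) : ResidualChainsEnd G := by
  intro l K hK
  obtain ⟨i, hi⟩ := hQ l _ (hK.map (QuotientGroup.mk' N))
  refine of_bot_of_subgroup hN hK ⟨i, ?_⟩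
  have := (Subgroup.map_eq_bot_iff _).1 hi
  rwa [QuotientGroup.ker_mk'] at this

/-- The first term is finitely generated, hence contained in one `H m`, and so is the whole chain.
-/
theorem union (H : ℕ → Subgroup G) (hmono : Monotone H) (hunion : ∀ g, ∃ n, g ∈ H n)
    (hH : ∀ n, ResidualChainsEnd (H n)) : ResidualChainsEnd G := by
  intro l K hK
  obtain ⟨S, hS, hfin⟩ := (Subgroup.fg_iff _).1 ((Group.fg_iff_subgroup_fg _).1 (hK.1 0))
  choose n hn using hunion
  obtain ⟨m, hm⟩ := (hfin.image n).bddAbove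
  refine of_bot_of_subgroup (hH m) hK ⟨0, ?_⟩
  rw [← hS, Subgroup.closure_le]
  exact fun g hg => hmono (hm (Set.mem_image_of_mem n hg)) (hn g)

end ResidualChainsEnd

/-- All subquotients of elementary amenable groups have only terminating residual chains. -/
theorem IsElementaryAmenable.residualChainsEnd_subquotient {G : Type} [Group G]
    (hG : IsElementaryAmenable G) : ∀ (H R : Type) [Group H] [Group R] (i : H →* G) (q : H →* R),
      Function.Injective i → Function.Surjective q → ResidualChainsEnd R := by
  -- Working with all subquotients reduces the subgroup and quotient clauses to replacing the
  -- ambient group.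
  induction hG with
  | of_finite G h =>
    intro H R _ _ i q hi hq
    have := Finite.of_injective i hi
    have := Finite.of_surjective q hq
    exact .of_finite
  | of_comm G _ h =>
    intro H R _ _ i q hi hq
    refine .of_comm fun a b => ?_
    obtain ⟨a, rfl⟩ := hq a
    obtain ⟨b, rfl⟩ := hq b
    rw [← map_mul, ← map_mul]
    congr 1
    apply hi
    rw [map_mul, map_mul, h]
  | extension N G Q j p hj hp hjp _ _ ihN ihQ =>
    intro H R _ _ i q hi hq
    set K := (p.comp i).ker with hK
    have : (K.map q).Normal := Subgroup.Normal.map inferInstance q hq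
    refine .extension (K.map q) ?_ ?_
    · let e : K →* j.range := (i.comp K.subtype).codRestrict j.range fun x => by
        rw [hjp]; exact x.2
      have he : Function.Injective e := fun x y h => Subtype.ext (hi (congrArg Subtype.val h))
      exact ihN K _ ((MonoidHom.ofInjective hj).symm.toMonoidHom.comp e) (q.subgroupMap K)
        ((MonoidHom.ofInjective hj).symm.injective.comp he) (q.subgroupMap_surjective K)
    · refine ihQ (H ⧸ K) _ (QuotientGroup.kerLift (p.comp i))
        (QuotientGroup.map K (K.map q) q (Subgroup.le_comap_map _ _))
        (QuotientGroup.kerLift_injective _) ?_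
      intro y
      obtain ⟨y, rfl⟩ := QuotientGroup.mk_surjective y
      obtain ⟨x, rfl⟩ := hq y
      exact ⟨(x : H ⧸ K), rfl⟩
  | union G U hmono hunion _ ih =>
    intro H R _ _ i q hi hq
    refine .union (fun n => ((U n).comap i).map q)
      (fun m n h => Subgroup.map_mono (Subgroup.comap_mono (hmono h))) ?_ fun n => ?_
    · intro r
      obtain ⟨h, rfl⟩ := hq r
      obtain ⟨n, hn⟩ := hunion (i h)
      exact ⟨n, Subgroup.mem_map_of_mem q hn⟩
    · exact ih n ((U n).comap i) _ (i.subgroupComap (U n)) (q.subgroupMap _)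
        (fun x y h => Subtype.ext (hi (congrArg Subtype.val h))) (q.subgroupMap_surjective _)
  | subgroup H G i hi _ ih =>
    intro H' R _ _ i' q hi' hq
    exact ih H' R (i.comp i') q (hi.comp hi') hq
  | quotient G Q p hp _ ih =>
    intro H R _ _ i q hi hq
    -- A subgroup of the quotient is itself a quotient of its preimage in `G`.
    have hj : Function.Surjective (p.subgroupComap i.range) := fun ⟨y, hy⟩ => by
      obtain ⟨x, rfl⟩ := hp y
      exact ⟨⟨x, hy⟩, rfl⟩
    exact ih (i.range.comap p) R (i.range.comap p).subtype
      ((q.comp (MonoidHom.ofInjective hi).symm.toMonoidHom).comp (p.subgroupComap i.range))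
      Subtype.val_injective ((hq.comp (MonoidHom.ofInjective hi).symm.surjective).comp hj)

theorem IsElementaryAmenable.residualChainsEnd {G : Type} [Group G]
    (hG : IsElementaryAmenable G) : ResidualChainsEnd G :=
  hG.residualChainsEnd_subquotient G G (MonoidHom.id G) (MonoidHom.id G)
    Function.injective_id Function.surjective_id

/-! ### Recovering a finitely generated group from its residual. -/

/-- Such an `M` is the kernel of the action on `G ⧸ M`, and a finitely generated group has only
finitely many homomorphisms to a given finite symmetric group. -/
theorem finite_setOf_normal_index_le (G : Type*) [Group G] [Group.FG G] (n : ℕ) :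
    {M : Subgroup G | M.Normal ∧ M.index ≠ 0 ∧ M.index ≤ n}.Finite := by
  have hfin : ∀ m : ℕ, Finite (G →* Equiv.Perm (Fin m)) := fun m => by
    obtain ⟨S, hS, hf⟩ := Group.fg_iff.1 ‹Group.FG G›
    have := hf.to_subtype
    refine Finite.of_injective (fun (φ : G →* Equiv.Perm (Fin m)) (s : S) => φ s) fun φ ψ h => ?_
    exact MonoidHom.eq_of_eqOn_dense hS fun s hs => congrFun h ⟨s, hs⟩
  refine (Set.finite_iUnion fun m : Fin (n + 1) =>
    Set.finite_range fun φ : G →* Equiv.Perm (Fin m) => φ.ker).subset ?_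
  rintro M ⟨hM, h0, hn⟩
  refine mem_iUnion.2 ⟨⟨M.index, Nat.lt_succ_of_le hn⟩, ?_⟩
  have : Finite (G ⧸ M) := Nat.finite_of_card_ne_zero h0
  let e : G ⧸ M ≃ Fin M.index := Finite.equivFin _
  refine ⟨(e.permCongrHom.toMonoidHom.comp (MulAction.toPermHom (G ⧸ M) (G ⧸ M))).comp
    (QuotientGroup.mk' M), ?_⟩
  have hinj : Function.Injective (e.permCongrHom.toMonoidHom.comp
      (MulAction.toPermHom (G ⧸ M) (G ⧸ M))) :=
    e.permCongrHom.injective.comp MulAction.toPerm_injective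
  dsimp only
  rw [MonoidHom.ker_comp_of_injective _ _ hinj, QuotientGroup.ker_mk']

theorem finiteIndex_sInf_normal_index_le (G : Type*) [Group G] [Group.FG G] (n : ℕ) :
    (sInf {M : Subgroup G | M.Normal ∧ M.index ≠ 0 ∧ M.index ≤ n}).index ≠ 0 := by
  have := (finite_setOf_normal_index_le G n).to_subtype
  rw [sInf_eq_iInf']
  exact Subgroup.index_iInf_ne_zero fun M => M.2.2.1

theorem IsElementaryAmenable.of_mulEquiv {G H : Type} [Group G] [Group H]
    (hG : IsElementaryAmenable G) (e : H ≃* G) : IsElementaryAmenable H :=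
  .subgroup H G e.toMonoidHom e.injective hG

theorem IsElementaryAmenable.of_normal {G : Type} [Group G] (N : Subgroup G) [N.Normal]
    (hN : IsElementaryAmenable N) (hQ : IsElementaryAmenable (G ⧸ N)) : IsElementaryAmenable G :=
  .extension N G (G ⧸ N) N.subtype (QuotientGroup.mk' N) Subtype.val_injective
    (QuotientGroup.mk'_surjective N) (by rw [Subgroup.range_subtype, QuotientGroup.ker_mk']) hN hQ

theorem IsElementaryAmenable.of_commFiniteResidual {G : Type} [Group G] [Group.FG G] {k : ℕ}
    (h : IsElementaryAmenable (commFiniteResidual G k)) : IsElementaryAmenable G := by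
  set I := sInf {M : Subgroup G | M.Normal ∧ M.index ≠ 0 ∧ M.index ≤ k + 1} with hI
  have hIn : I.Normal := by
    refine ⟨fun a ha g => ?_⟩
    rw [hI, Subgroup.mem_sInf] at ha ⊢
    exact fun M hM => hM.1.conj_mem a (ha M hM) g
  have hc : Countable G := by
    obtain ⟨α, _, φ, hφ⟩ := Group.fg_iff_exists_freeGroup_hom_surjective_finite.1 ‹_›
    exact hφ.countable
  -- Along the series from `G` through `commutator G` to its intersection with `I`, the factors are
  -- abelian and finite, and the bottom term is the residual.
  refine .of_normal (commutator G) (.of_normal (I.subgroupOf (commutator G)) ?_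
    (.of_finite _ (Nat.finite_of_card_ne_zero ?_))) (.of_comm _ Quotient.countable ?_)
  · refine .subgroup _ _ (((commutator G).subtype.comp (Subgroup.subtype _)).codRestrict
      (commFiniteResidual G k) fun x => ⟨x.1.2, x.2⟩) (fun x y hxy => ?_) h
    have hval := congrArg Subtype.val hxy
    exact Subtype.ext (Subtype.ext hval)
  · intro h0
    have hdvd := Subgroup.relIndex_dvd_index_of_normal I (commutator G)
    rw [show I.relIndex (commutator G) = 0 from h0] at hdvd
    exact finiteIndex_sInf_normal_index_le G (k + 1) (zero_dvd_iff.1 hdvd)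
  · exact fun a b => mul_comm (G := Abelianization G) a b

/-! ### Marked subgroups as pullbacks along endomorphisms of the free group. -/

namespace MarkedGroup

variable (γ : ℕ → FreeGroup ℕ)

/-- A marked group obtained by pulling back along `π` is isomorphic to the image of `f_N ∘ π`. -/
noncomputable def pullbackEquiv (G : MarkedGroup) (π : FreeGroup ℕ →* FreeGroup ℕ) :
    (G.pullback π).Carrier ≃* (G.proj.comp π).range :=
  QuotientGroup.quotientKerEquivRange (G.proj.comp π)

theorem proj_surjective (G : MarkedGroup) : Function.Surjective G.proj :=
  QuotientGroup.mk'_surjective _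

theorem proj_eq_one {G : MarkedGroup} {w : FreeGroup ℕ} : G.proj w = 1 ↔ w ∈ G.ker :=
  QuotientGroup.eq_one_iff w

theorem pullback_pullback (G : MarkedGroup) (π ρ : FreeGroup ℕ →* FreeGroup ℕ) :
    (G.pullback π).pullback ρ = G.pullback (π.comp ρ) := by
  ext w
  exact proj_eq_one (G := G.pullback π)

theorem pullback_id (G : MarkedGroup) : G.pullback (MonoidHom.id _) = G := by
  ext w
  exact proj_eq_one

/-- The endomorphism `a_i ↦ γ_i` for `i ≤ n` and `a_i ↦ e` for `i > n`. -/
noncomputable def endoR (n : ℕ) : FreeGroup ℕ →* FreeGroup ℕ :=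
  FreeGroup.lift fun i => if i ≤ n then γ i else 1

open Classical in
/-- The endomorphism `a_i ↦ γ_i` if `g_i ∈ H` and `a_i ↦ e` if not. -/
noncomputable def endoSubgroup (G : MarkedGroup) (H : Subgroup G.Carrier) :
    FreeGroup ℕ →* FreeGroup ℕ :=
  FreeGroup.lift fun i => if G.proj (γ i) ∈ H then γ i else 1

theorem range_endoR (n : ℕ) : (endoR γ n).range = Subgroup.closure (γ '' Iic n) := by
  apply le_antisymm
  · refine FreeGroup.range_lift_le ?_
    rintro _ ⟨i, rfl⟩
    dsimp only
    split_ifs with h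
    · exact Subgroup.subset_closure ⟨i, h, rfl⟩
    · exact one_mem _
  · rw [Subgroup.closure_le]
    rintro _ ⟨i, hi, rfl⟩
    exact ⟨FreeGroup.of i, by simp [endoR, mem_Iic.1 hi]⟩

theorem fg_range_proj_comp_endoR (G : MarkedGroup) (π : FreeGroup ℕ →* FreeGroup ℕ) (n : ℕ) :
    Group.FG (G.proj.comp (π.comp (endoR γ n))).range := by
  have : Group.FG (endoR γ n).range := by
    rw [range_endoR]
    have := ((finite_Iic n).image γ).to_subtype
    infer_instance
  have h : (G.proj.comp (π.comp (endoR γ n))).range =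
      (endoR γ n).range.map (G.proj.comp π) := by
    rw [← MonoidHom.comp_assoc, MonoidHom.range_comp]
  rw [h]
  exact Group.fg_of_surjective ((G.proj.comp π).subgroupMap_surjective _)

theorem fg_carrier_R (n : ℕ) (G : MarkedGroup) : Group.FG (R γ n G).Carrier := by
  have : Group.FG (G.proj.comp (endoR γ n)).range :=
    fg_range_proj_comp_endoR γ G (MonoidHom.id _) n
  exact Group.fg_of_surjective (f := (G.pullbackEquiv (endoR γ n)).symm.toMonoidHom)
    (G.pullbackEquiv (endoR γ n)).symm.surjective

theorem proj_endoSubgroup_mem (G : MarkedGroup) (H : Subgroup G.Carrier) (w : FreeGroup ℕ) :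
    G.proj (endoSubgroup γ G H w) ∈ H := by
  have : (endoSubgroup γ G H).range ≤ H.comap G.proj := by
    refine FreeGroup.range_lift_le ?_
    rintro _ ⟨i, rfl⟩
    dsimp only
    split_ifs with h
    · exact h
    · exact one_mem _
  exact this ⟨w, rfl⟩

variable {γ}

theorem range_endoSubgroup (hγ : Function.Surjective γ) (G : MarkedGroup)
    (H : Subgroup G.Carrier) : (G.proj.comp (endoSubgroup γ G H)).range = H := by
  apply le_antisymm
  · rintro _ ⟨w, rfl⟩
    exact proj_endoSubgroup_mem γ G H w
  · intro h hh
    obtain ⟨w, rfl⟩ := G.proj_surjective h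
    obtain ⟨i, rfl⟩ := hγ w
    exact ⟨FreeGroup.of i, by simp [endoSubgroup, hh]⟩

/-- A marked group is elementary amenable if all the `S_k(R_n(G))` are. -/
theorem isElementaryAmenable_of_S_R (hγ : Function.Surjective γ) (G : MarkedGroup) (k : ℕ)
    (h : ∀ n, IsElementaryAmenable (S γ k (R γ n G)).Carrier) : IsElementaryAmenable G.Carrier := by
  have hrange : ∀ n, (G.proj.comp (endoR γ n)).range =
      (Subgroup.closure (γ '' Iic n)).map G.proj := fun n => by
    rw [MonoidHom.range_comp, range_endoR]
  refine .union _ (fun n => (G.proj.comp (endoR γ n)).range) ?_ ?_ fun n => ?_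
  · intro m n hmn
    dsimp only
    rw [hrange, hrange]
    exact Subgroup.map_mono (Subgroup.closure_mono (image_mono (Iic_subset_Iic.2 hmn)))
  · intro g
    obtain ⟨w, rfl⟩ := G.proj_surjective g
    obtain ⟨i, rfl⟩ := hγ w
    refine ⟨i, ?_⟩
    rw [hrange]
    exact Subgroup.mem_map_of_mem _ (Subgroup.subset_closure ⟨i, mem_Iic.2 le_rfl, rfl⟩)
  · refine IsElementaryAmenable.of_mulEquiv ?_ (G.pullbackEquiv (endoR γ n)).symm
    have := fg_carrier_R γ n G
    refine IsElementaryAmenable.of_commFiniteResidual (G := (R γ n G).Carrier) (k := k) ?_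
    have hn := h n
    have e := (R γ n G).pullbackEquiv (endoSubgroup γ _ (commFiniteResidual (R γ n G).Carrier k))
    rw [range_endoSubgroup hγ] at e
    exact hn.of_mulEquiv e.symm

/-! ### Well-founded decomposition trees and elementary amenability. -/

variable (γ)

/-- The marked group `G_s` for the reversal of the given list; it is defined for all lists, also
for those that are not in the decomposition tree. -/
noncomputable def groupAt (l : ℕ) (G : MarkedGroup) : List ℕ → MarkedGroup
  | [] => G
  | n :: s => S γ (s.length + l) (R γ n (groupAt l G s))

/-- The reversal of the given list is a node of the decomposition tree. -/
def InTree (l : ℕ) (G : MarkedGroup) : List ℕ → Prop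
  | [] => True
  | _ :: s => InTree l G s ∧ Nontrivial (groupAt γ l G s).Carrier

theorem decompNode_iff (l : ℕ) (G : MarkedGroup) (s : List ℕ) (H : MarkedGroup) :
    DecompNode γ l G s H ↔ InTree γ l G s.reverse ∧ H = groupAt γ l G s.reverse := by
  constructor
  · intro h
    induction h with
    | nil => exact ⟨trivial, rfl⟩
    | snoc s H n _ hH ih =>
      rw [List.reverse_append, List.reverse_singleton, List.singleton_append]
      obtain ⟨h1, rfl⟩ := ih
      exact ⟨⟨h1, hH⟩, by rw [groupAt, List.length_reverse]⟩
  · rintro ⟨h, rfl⟩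
    induction s using List.reverseRecOn with
    | nil => exact .nil
    | append_singleton s n ih =>
      rw [List.reverse_append, List.reverse_singleton, List.singleton_append] at h ⊢
      have := DecompNode.snoc s _ n (ih h.1) h.2
      rwa [← List.length_reverse (as := s)] at this

theorem mem_decompositionTree_iff (l : ℕ) (G : MarkedGroup) (s : List ℕ) :
    s ∈ (decompositionTree γ l G).nodes ↔ InTree γ l G s.reverse :=
  ⟨fun ⟨_, hH⟩ => ((decompNode_iff γ l G s _).1 hH).1,
    fun h => ⟨_, (decompNode_iff γ l G s _).2 ⟨h, rfl⟩⟩⟩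

theorem nil_mem_decompositionTree (l : ℕ) (G : MarkedGroup) :
    [] ∈ (decompositionTree γ l G).nodes := ⟨G, .nil⟩

variable {γ}

/-- Well-founded induction on nodes: a trivial group is finite, and otherwise all children are
elementary amenable. -/
theorem isElementaryAmenable_of_wf (hγ : Function.Surjective γ) {l : ℕ} {G : MarkedGroup}
    (h : (decompositionTree γ l G).WF) : IsElementaryAmenable G.Carrier := by
  suffices ∀ s H, DecompNode γ l G s H → IsElementaryAmenable H.Carrier from this [] G .nil
  intro s
  induction s using h.wellFounded.induction with
  | _ s ih =>
  intro H hs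
  by_cases hH : Nontrivial H.Carrier
  · refine isElementaryAmenable_of_S_R hγ H (s.length + l) fun n => ?_
    have hn := DecompNode.snoc s H n hs hH
    exact ih (s ++ [n]) ⟨⟨_, hn⟩, ⟨_, hs⟩, List.prefix_append _ _, by simp⟩ _ hn
  · have := not_nontrivial_iff_subsingleton.1 hH
    exact .of_finite _ inferInstance

variable (γ)

/-- An endomorphism of the free group realizing `groupAt` as a pullback. -/
noncomputable def endoAt (l : ℕ) (G : MarkedGroup) : List ℕ → (FreeGroup ℕ →* FreeGroup ℕ)
  | [] => MonoidHom.id _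
  | n :: s => ((endoAt l G s).comp (endoR γ n)).comp (endoSubgroup γ (R γ n (groupAt γ l G s))
      (commFiniteResidual (R γ n (groupAt γ l G s)).Carrier (s.length + l)))

theorem groupAt_eq_pullback (l : ℕ) (G : MarkedGroup) (s : List ℕ) :
    groupAt γ l G s = G.pullback (endoAt γ l G s) := by
  induction s with
  | nil => exact (pullback_id G).symm
  | cons n s ih =>
    rw [endoAt, ← pullback_pullback, ← pullback_pullback, ← ih]
    rfl

theorem proj_comp_mem_commFiniteResidual {G A : MarkedGroup} {π : FreeGroup ℕ →* FreeGroup ℕ}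
    (hA : A = G.pullback π) {k : ℕ} {w : FreeGroup ℕ}
    (hw : A.proj w ∈ commFiniteResidual A.Carrier k) :
    (⟨G.proj (π w), w, rfl⟩ : (G.proj.comp π).range) ∈
      commFiniteResidual (G.proj.comp π).range k := by
  subst hA
  exact map_mem_commFiniteResidual (G.pullbackEquiv π).toMonoidHom hw

theorem wf_decompositionTree {G : MarkedGroup} (hG : IsElementaryAmenable G.Carrier) (l : ℕ) :
    (decompositionTree γ l G).WF := by
  rintro ⟨x, hx⟩
  let s : ℕ → List ℕ := fun i => ((List.range i).map x).reverse
  have hs : ∀ i, s (i + 1) = x i :: s i := fun i => by simp [s, List.range_succ]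
  have hlen : ∀ i, (s i).length = i := fun i => by simp [s]
  have hnt : ∀ i, Nontrivial (groupAt γ l G (s i)).Carrier := fun i => by
    have := (mem_decompositionTree_iff γ l G _).1 (hx (i + 1))
    change InTree γ l G (s (i + 1)) at this
    rw [hs] at this
    exact this.2
  -- The groups `R_{x i}(G_s)` along the branch are realized inside the one group `G`.
  let K : ℕ → Subgroup G.Carrier := fun i =>
    (G.proj.comp ((endoAt γ l G (s i)).comp (endoR γ (x i)))).range
  have hK : IsResidualChain G.Carrier l K := by
    refine ⟨fun i => fg_range_proj_comp_endoR γ G _ _, fun i => ?_⟩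
    rintro _ ⟨w, rfl⟩
    have hA : R γ (x i) (groupAt γ l G (s i)) =
        G.pullback ((endoAt γ l G (s i)).comp (endoR γ (x i))) := by
      rw [← pullback_pullback, ← groupAt_eq_pullback]
      rfl
    have := proj_comp_mem_commFiniteResidual hA
      (proj_endoSubgroup_mem γ _ (commFiniteResidual _ ((s i).length + l)) (endoR γ (x (i + 1)) w))
    rw [hlen] at this
    simp only [MonoidHom.comp_apply, hs, endoAt, hlen] at this ⊢
    exact ⟨⟨_, rfl⟩, this⟩
  obtain ⟨i, hi⟩ := hG.residualChainsEnd l K hK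
  -- The group at the next node embeds in `K i = ⊥`, yet is nontrivial because the branch continues
  -- past it.
  have hnt' := hnt (i + 1)
  rw [groupAt_eq_pullback] at hnt'
  obtain ⟨⟨g, hg⟩, hne⟩ := (nontrivial_iff_exists_ne 1).1
    (G.pullbackEquiv (endoAt γ l G (s (i + 1)))).symm.toEquiv.nontrivial
  obtain ⟨w, rfl⟩ := hg
  refine hne (Subtype.ext ?_)
  have : G.proj (endoAt γ l G (s (i + 1)) w) ∈ K i := by
    rw [hs]
    exact ⟨_, rfl⟩
  rw [hi] at this
  exact this

end MarkedGroup

/-! ### Borel dependence of the trees on the marked group. -/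

/-- The pigeonhole form mentions only membership in `M`, with finite disjunctions, so it defines a
closed condition on marked groups. -/
theorem Subgroup.index_le_iff_forall_fin {G : Type*} [Group G] (M : Subgroup G) (n : ℕ) :
    (M.index ≠ 0 ∧ M.index ≤ n) ↔
      ∀ f : Fin (n + 1) → G, ∃ i j, i ≠ j ∧ (f i)⁻¹ * f j ∈ M := by
  constructor
  · rintro ⟨h0, hn⟩ f
    have : Finite (G ⧸ M) := Nat.finite_of_card_ne_zero h0
    by_contra! hf
    have hinj : Function.Injective fun i => (f i : G ⧸ M) := fun i j hij => by
      by_contra hne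
      exact hf i j hne (QuotientGroup.eq.1 hij)
    have := Nat.card_le_card_of_injective _ hinj
    rw [Nat.card_fin] at this
    exact absurd (this.trans hn) (by omega)
  · intro h
    have hno : ¬ ∃ e : Fin (n + 1) → G ⧸ M, Function.Injective e := by
      rintro ⟨e, he⟩
      obtain ⟨i, j, hne, hij⟩ := h fun i => (e i).out
      refine hne (he ?_)
      rw [← QuotientGroup.eq, QuotientGroup.out_eq', QuotientGroup.out_eq'] at hij
      exact hij
    have hfin : Finite (G ⧸ M) := by
      by_contra hinf
      have := not_finite_iff_infinite.1 hinf
      exact hno ⟨fun i => Infinite.natEmbedding _ i.1,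
        (Infinite.natEmbedding _).injective.comp Fin.val_injective⟩
    refine ⟨Nat.card_pos.ne', ?_⟩
    by_contra! hlt
    exact hno ⟨fun i => (Finite.equivFin (G ⧸ M)).symm (Fin.castLE hlt i),
      (Finite.equivFin (G ⧸ M)).symm.injective.comp (Fin.castLE_injective hlt)⟩

theorem Measurable.pred_comp_countable {X ι : Type*} [MeasurableSpace X] [MeasurableSpace ι]
    [Countable ι] [MeasurableSingletonClass ι] {g : X → ι} (hg : Measurable g) {P : ι → X → Prop}
    (hP : ∀ i, Measurable (P i)) : Measurable fun x => P (g x) x := by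
  have : (fun x => P (g x) x) = fun x => ∃ i, g x = i ∧ P i x := by
    ext x
    simp
  rw [this]
  exact Measurable.exists fun i =>
    (measurableSet_setOfPred.1 (hg (measurableSet_singleton i))).and (hP i)

namespace MarkedGroup

noncomputable instance : MeasurableSpace MarkedGroup := borel _

instance : BorelSpace MarkedGroup := ⟨rfl⟩

instance : CompactSpace MarkedGroup := isClosedEmbedding_charFun.compactSpace

theorem isClopen_mem_ker (w : FreeGroup ℕ) : IsClopen {G : MarkedGroup | w ∈ G.ker} := by
  have h : {G : MarkedGroup | w ∈ G.ker} = charFun ⁻¹' {x | x w = true} := by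
    ext G
    simp [charFun]
  rw [h]
  exact ((isClopen_discrete ({true} : Set Bool)).preimage (continuous_apply w)).preimage
    isClosedEmbedding_charFun.continuous

theorem measurable_mem_ker (w : FreeGroup ℕ) : Measurable fun G : MarkedGroup => w ∈ G.ker :=
  measurableSet_setOfPred.1 (isClopen_mem_ker w).isClosed.measurableSet

theorem measurable_of_mem_ker {X : Type*} [MeasurableSpace X] {F : X → MarkedGroup}
    (hF : ∀ w, Measurable fun x => w ∈ (F x).ker) : Measurable F := by
  have h : borel MarkedGroup =
      MeasurableSpace.comap charFun MeasurableSpace.pi := by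
    rw [BorelSpace.measurable_eq (α := FreeGroup ℕ → Bool)]
    exact borel_comap
  rw [BorelSpace.measurable_eq (α := MarkedGroup), h, measurable_comap_iff, measurable_pi_iff]
  intro w
  refine measurable_to_bool ?_
  convert measurableSet_setOfPred.2 (hF w) using 1
  ext x
  simp [charFun]

theorem measurable_pullback (π : FreeGroup ℕ →* FreeGroup ℕ) :
    Measurable fun G : MarkedGroup => G.pullback π :=
  measurable_of_mem_ker fun w => by
    have h : ∀ G : MarkedGroup, w ∈ (G.pullback π).ker ↔ π w ∈ G.ker := fun G => proj_eq_one
    simp only [h]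
    exact measurable_mem_ker _

/-- The endomorphism defining `S` varies with the group, so its values on words must also be tracked
measurably. -/
theorem measurable_lift_eq {X : Type*} [MeasurableSpace X] {c : X → ℕ → FreeGroup ℕ}
    (hc : ∀ i v, Measurable fun x => c x i = v) (w v : FreeGroup ℕ) :
    Measurable fun x => FreeGroup.lift (c x) w = v := by
  induction w using FreeGroup.induction_on generalizing v with
  | C1 => simp only [map_one]; exact measurable_const
  | of i => simpa only [FreeGroup.lift_apply_of] using hc i v
  | inv_of i _ =>
    simp only [map_inv, FreeGroup.lift_apply_of, inv_eq_iff_eq_inv]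
    exact hc i v⁻¹
  | mul a b ha hb =>
    have h : ∀ x, FreeGroup.lift (c x) (a * b) = v ↔
        ∃ u, FreeGroup.lift (c x) a = u ∧ FreeGroup.lift (c x) b = u⁻¹ * v := fun x => by
      rw [map_mul]
      constructor
      · rintro rfl
        exact ⟨_, rfl, by group⟩
      · rintro ⟨u, rfl, h⟩
        rw [h]
        group
    simp only [h]
    exact Measurable.exists fun u => (ha u).and (hb _)

theorem proj_mem_commutator_iff (G : MarkedGroup) (v : FreeGroup ℕ) :
    G.proj v ∈ commutator G.Carrier ↔ ∃ c ∈ commutator (FreeGroup ℕ), c⁻¹ * v ∈ G.ker := by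
  have h : commutator G.Carrier = (commutator (FreeGroup ℕ)).map G.proj := by
    rw [map_commutator_eq, MonoidHom.range_eq_top.2 G.proj_surjective, commutator_def]
  rw [h, Subgroup.mem_map]
  exact exists_congr fun c => and_congr_right fun _ => QuotientGroup.eq

/-- Normal subgroups of the quotient correspond to points of the space above `G.ker`, which turns
the quantifier over subgroups into one over a compact space. -/
theorem forall_normal_proj_mem_iff (G : MarkedGroup) (v : FreeGroup ℕ) (k : ℕ) :
    (∀ M : Subgroup G.Carrier, M.Normal → M.index ≠ 0 → M.index ≤ k + 1 → G.proj v ∈ M) ↔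
      ¬ ∃ M : MarkedGroup, G.ker ≤ M.ker ∧ v ∉ M.ker ∧
        ∀ f : Fin (k + 2) → FreeGroup ℕ, ∃ i j, i ≠ j ∧ (f i)⁻¹ * f j ∈ M.ker := by
  simp only [← Subgroup.index_le_iff_forall_fin]
  constructor
  · rintro h ⟨M, hle, hv, h0, hk⟩
    have hcomap : (M.ker.map G.proj).comap G.proj = M.ker := by
      rw [Subgroup.comap_map_eq, proj, QuotientGroup.ker_mk', sup_eq_left.2 hle]
    have hi : (M.ker.map G.proj).index = M.ker.index := by
      rw [← Subgroup.index_comap_of_surjective _ G.proj_surjective, hcomap]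
    refine hv ?_
    rw [← hcomap]
    exact h _ (M.normal.map _ G.proj_surjective) (hi ▸ h0) (hi ▸ hk)
  · intro h M hM h0 hk
    by_contra hv
    have hi := Subgroup.index_comap_of_surjective M G.proj_surjective
    refine h ⟨⟨M.comap G.proj, hM.comap _⟩, fun w hw => ?_, hv, hi ▸ h0, hi ▸ hk⟩
    rw [Subgroup.mem_comap, proj_eq_one.2 hw]
    exact one_mem _

theorem measurable_proj_mem_commFiniteResidual (k : ℕ) (v : FreeGroup ℕ) :
    Measurable fun G : MarkedGroup => G.proj v ∈ commFiniteResidual G.Carrier k := by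
  simp only [mem_commFiniteResidual, proj_mem_commutator_iff, forall_normal_proj_mem_iff]
  refine .and (.exists fun c => measurable_const.and (measurable_mem_ker _)) (.not ?_)
  rw [← measurableSet_setOfPred]
  have himage : {G : MarkedGroup | ∃ M : MarkedGroup, G.ker ≤ M.ker ∧ v ∉ M.ker ∧
        ∀ f : Fin (k + 2) → FreeGroup ℕ, ∃ i j, i ≠ j ∧ (f i)⁻¹ * f j ∈ M.ker} =
      Prod.fst '' {p : MarkedGroup × MarkedGroup | (∀ w, w ∈ p.1.ker → w ∈ p.2.ker) ∧
        v ∉ p.2.ker ∧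
        ∀ f : Fin (k + 2) → FreeGroup ℕ, ∃ i j, i ≠ j ∧ (f i)⁻¹ * f j ∈ p.2.ker} := by
    ext G
    exact ⟨fun ⟨M, h⟩ => ⟨(G, M), h, rfl⟩, by rintro ⟨⟨G, M⟩, h, rfl⟩; exact ⟨M, h⟩⟩
  -- The projection of a closed subset of a compact space is closed, so this quantifier does not
  -- leave the Borel sets.
  rw [himage]
  have h1 : ∀ w, IsClopen {p : MarkedGroup × MarkedGroup | w ∈ p.1.ker} := fun w =>
    (isClopen_mem_ker w).preimage continuous_fst
  have h2 : ∀ w, IsClopen {p : MarkedGroup × MarkedGroup | w ∈ p.2.ker} := fun w =>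
    (isClopen_mem_ker w).preimage continuous_snd
  refine (IsCompact.image (IsClosed.isCompact ?_) continuous_fst).isClosed.measurableSet
  refine IsClosed.inter ?_ (IsClosed.inter (h2 v).compl.isClosed ?_)
  · change IsClosed {p : MarkedGroup × MarkedGroup | ∀ w, w ∈ p.1.ker → w ∈ p.2.ker}
    simp only [ofPred_forall]
    exact isClosed_iInter fun w => isClosed_imp (h1 w).isOpen (h2 w).isClosed
  · change IsClosed {p : MarkedGroup × MarkedGroup | ∀ f : Fin (k + 2) → FreeGroup ℕ,
      ∃ i j, i ≠ j ∧ (f i)⁻¹ * f j ∈ p.2.ker}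
    simp only [ofPred_forall, ofPred_exists]
    refine isClosed_iInter fun f => isClosed_iUnion_of_finite fun i =>
      isClosed_iUnion_of_finite fun j => IsClosed.inter isClosed_const (h2 _).isClosed

variable (γ : ℕ → FreeGroup ℕ)

theorem measurable_S (k : ℕ) : Measurable (S γ k) := by
  refine measurable_of_mem_ker fun w => ?_
  have h : ∀ G : MarkedGroup, w ∈ (S γ k G).ker ↔ ∃ v,
      endoSubgroup γ G (commFiniteResidual G.Carrier k) w = v ∧ v ∈ G.ker := fun G =>
    (proj_eq_one (G := G)).trans (by simp only [exists_eq_left']; rfl)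
  simp only [h]
  refine .exists fun v => (measurable_lift_eq (fun i v => ?_) w v).and (measurable_mem_ker v)
  have hm := measurable_proj_mem_commFiniteResidual k (γ i)
  classical
  have hite : ∀ G : MarkedGroup,
      ((if G.proj (γ i) ∈ commFiniteResidual G.Carrier k then γ i else 1) = v) ↔
      ((G.proj (γ i) ∈ commFiniteResidual G.Carrier k → γ i = v) ∧
      (G.proj (γ i) ∉ commFiniteResidual G.Carrier k → 1 = v)) := fun G => by
    split_ifs with hG <;> simp [hG]
  have hm' := (hm.imp (measurable_const (a := γ i = v))).and
    (hm.not.imp (measurable_const (a := 1 = v)))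
  exact (funext fun G => propext (hite G).symm) ▸ hm'

theorem measurable_groupAt (l : ℕ) (s : List ℕ) : Measurable fun G => groupAt γ l G s := by
  induction s with
  | nil => exact measurable_id
  | cons n s ih => exact (measurable_S γ _).comp ((measurable_pullback _).comp ih)

theorem measurable_nontrivial : Measurable fun G : MarkedGroup => Nontrivial G.Carrier := by
  have h : ∀ G : MarkedGroup, Nontrivial G.Carrier ↔ ∃ w, w ∉ G.ker := fun G => by
    rw [nontrivial_iff_exists_ne 1, G.proj_surjective.exists]
    simp only [ne_eq, proj_eq_one]
  simp only [h]
  exact .exists fun w => (measurable_mem_ker w).not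

theorem measurable_inTree (l : ℕ) (s : List ℕ) : Measurable fun G => InTree γ l G s := by
  induction s with
  | nil => exact measurable_const
  | cons n s ih => exact ih.and (measurable_nontrivial.comp (measurable_groupAt γ l s))

theorem measurable_mem_decompositionTree (l : ℕ) (s : List ℕ) :
    Measurable fun G => s ∈ (decompositionTree γ l G).nodes := by
  simp only [mem_decompositionTree_iff]
  exact measurable_inTree γ l _

theorem measurable_extends (l : ℕ) (s t : List ℕ) :
    Measurable fun G => (decompositionTree γ l G).Extends s t :=
  (measurable_mem_decompositionTree γ l s).and
    ((measurable_mem_decompositionTree γ l t).and measurable_const)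

/-! ### Analytic comparison of trees and the rank relations. -/

/-- Existence of a map between decomposition trees, with a prescribed condition on the image of
the root, is an analytic condition. -/
theorem analyticSet_exists_isHom (l m : ℕ) (P : List ℕ → Prop) :
    MeasureTheory.AnalyticSet {p : MarkedGroup × MarkedGroup |
      ∃ f, (decompositionTree γ l p.1).IsHom (decompositionTree γ m p.2) f ∧ P (f [])} := by
  -- Coding nodes by numbers makes the maps points of the Polish space `List ℕ → ℕ`, along which a
  -- Borel set is projected.
  let dec : ℕ → List ℕ := Denumerable.ofNat (List ℕ)
  have himage : {p : MarkedGroup × MarkedGroup |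
      ∃ f, (decompositionTree γ l p.1).IsHom (decompositionTree γ m p.2) f ∧ P (f [])} =
      Prod.fst '' {q : (MarkedGroup × MarkedGroup) × (List ℕ → ℕ) |
        (decompositionTree γ l q.1.1).IsHom (decompositionTree γ m q.1.2) (dec ∘ q.2) ∧
        P (dec (q.2 []))} := by
    ext p
    constructor
    · rintro ⟨f, hf⟩
      have : dec ∘ (Encodable.encode ∘ f) = f := by
        ext1 s
        simp [dec]
      refine ⟨(p, Encodable.encode ∘ f), ⟨?_, ?_⟩, rfl⟩
      · exact this.symm ▸ hf.1
      · have h0 : dec (Encodable.encode (f [])) = f [] := congrFun this []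
        change P (dec (Encodable.encode (f [])))
        exact h0.symm ▸ hf.2
    · rintro ⟨⟨p, f⟩, hf, rfl⟩
      exact ⟨dec ∘ f, hf⟩
  rw [himage]
  refine (MeasurableSet.analyticSet ?_).image_of_continuous continuous_fst
  have heval : ∀ s, Measurable fun q : (MarkedGroup × MarkedGroup) × (List ℕ → ℕ) => q.2 s :=
    fun s => (measurable_pi_apply s).comp measurable_snd
  rw [measurableSet_setOfPred]
  refine .and (.and ?_ (.forall fun s => .forall fun t => .imp ?_ ?_)) ?_
  · exact (heval []).pred_comp_countable fun n =>
      (measurable_mem_decompositionTree γ m (dec n)).comp (measurable_snd.comp measurable_fst)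
  · exact (measurable_extends γ l s t).comp (measurable_fst.comp measurable_fst)
  · exact (heval s).pred_comp_countable fun a => (heval t).pred_comp_countable fun b =>
      (measurable_extends γ m (dec a) (dec b)).comp (measurable_snd.comp measurable_fst)
  · exact (heval []).pred_comp_countable (P := fun n _ => P (dec n)) fun n => measurable_const

/-- Comparison of decomposition ranks in terms of the ranks of the decomposition trees. -/
theorem decompositionRank_le_iff {x y : MarkedGroup} :
    decompositionRank γ x ≤ decompositionRank γ y ↔
      ∀ l : ℕ, ∃ m : ℕ, (decompositionTree γ (m + 1) x).rank ≤
        (decompositionTree γ (l + 1) y).rank := by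
  have hne : ∀ z : MarkedGroup,
      {α | ∃ l : ℕ, 1 ≤ l ∧ α = (decompositionTree γ l z).rank}.Nonempty :=
    fun z => ⟨_, 1, le_rfl, rfl⟩
  constructor
  · intro h l
    obtain ⟨m, hm, he⟩ := csInf_mem (hne x)
    obtain ⟨m, rfl⟩ := Nat.exists_eq_add_of_le' hm
    refine ⟨m, he ▸ h.trans (csInf_le' ⟨l + 1, by omega, rfl⟩)⟩
  · intro h
    obtain ⟨l, hl, he⟩ := csInf_mem (hne y)
    obtain ⟨l, rfl⟩ := Nat.exists_eq_add_of_le' hl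
    obtain ⟨m, hm⟩ := h l
    have hle : decompositionRank γ x ≤ (decompositionTree γ (m + 1) x).rank :=
      csInf_le' ⟨m + 1, by omega, rfl⟩
    exact hle.trans (hm.trans he.ge)

end MarkedGroup

/-- For every enumeration `γ` of the free group `F_ω`: the decomposition rank is defined on all
elementary amenable marked groups, and it is a `Π¹₁`-rank on the set of these groups. -/
theorem mainTheorem8 (γ : ℕ → FreeGroup ℕ) (hγ : Function.Surjective γ) :
    EG ⊆ MarkedGroup.W γ ∧
    IsPi11Rank EG (fun G : EG => MarkedGroup.decompositionRank γ G) := by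
  have hwf : ∀ G ∈ EG, ∀ l, (MarkedGroup.decompositionTree γ l G).WF :=
    fun G hG l => MarkedGroup.wf_decompositionTree γ hG l
  have hswap : Continuous (Prod.swap : MarkedGroup × MarkedGroup → _) := continuous_swap
  let A : ℕ → ℕ → Set (MarkedGroup × MarkedGroup) := fun l m => {p |
    ∃ f, (MarkedGroup.decompositionTree γ (m + 1) p.1).IsHom
      (MarkedGroup.decompositionTree γ (l + 1) p.2) f ∧ True}
  let B : ℕ → ℕ → Set (MarkedGroup × MarkedGroup) := fun l m => Prod.swap '' {p |
    ∃ f, (MarkedGroup.decompositionTree γ (l + 1) p.1).IsHom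
      (MarkedGroup.decompositionTree γ (m + 1) p.2) f ∧ f [] ≠ []}
  -- Membership of `x` in `EG` is absorbed into well-foundedness: it makes every tree of `x`
  -- well-founded, and one well-founded tree suffices to recover it.
  have hmain : ∀ (y : EG) (x : MarkedGroup),
      (∃ _ : x ∈ EG, MarkedGroup.decompositionRank γ x ≤ MarkedGroup.decompositionRank γ y) ↔
      ∀ l, ∃ m, (MarkedGroup.decompositionTree γ (m + 1) x).WF ∧
        (MarkedGroup.decompositionTree γ (m + 1) x).rank ≤
          (MarkedGroup.decompositionTree γ (l + 1) y).rank := by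
    intro y x
    rw [MarkedGroup.decompositionRank_le_iff]
    constructor
    · rintro ⟨hx, h⟩ l
      obtain ⟨m, hm⟩ := h l
      exact ⟨m, hwf x hx _, hm⟩
    · intro h
      obtain ⟨m, hm, -⟩ := h 0
      exact ⟨MarkedGroup.isElementaryAmenable_of_wf hγ hm, fun l => (h l).imp fun _ h => h.2⟩
  refine ⟨fun G hG => ⟨1, le_rfl, hwf G hG 1⟩, ⋂ l, ⋃ m, (B l m)ᶜ, ⋂ l, ⋃ m, A l m, ?_, ?_, ?_⟩
  · simp only [compl_iInter, compl_iUnion, compl_compl]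
    exact .iUnion fun l => .iInter fun m =>
      (MarkedGroup.analyticSet_exists_isHom γ (l + 1) (m + 1) (· ≠ [])).image_of_continuous hswap
  · exact .iInter fun l => .iUnion fun m =>
      MarkedGroup.analyticSet_exists_isHom γ (m + 1) (l + 1) fun _ => True
  · intro y x
    rw [hmain]
    have hnil := MarkedGroup.nil_mem_decompositionTree γ
    constructor
    · simp only [mem_iInter, mem_iUnion]
      refine forall_congr' fun l => exists_congr fun m => ?_
      rw [← (hwf y y.2 (l + 1)).exists_isHom_iff (hnil _ _) (hnil _ _)]
      simp only [A, mem_ofPred_eq, and_true]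
    · simp only [mem_iInter, mem_iUnion]
      refine forall_congr' fun l => exists_congr fun m => ?_
      rw [← not_not (a := _ ∧ _),
        ← (hwf y y.2 (l + 1)).exists_strict_isHom_iff (hnil _ _) (hnil _ _)]
      simp only [B, mem_compl_iff, image_swap_eq_preimage_swap, mem_preimage, Prod.swap_prod_mk,
        mem_ofPred_eq]
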